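/- Let $n\ge 0$ and let $\mathbb C^*=\mathbb C\setminus\{0\}$. A \emph{topological toric manifold} of dimension $2n$ is a closed (compact, Hausdorff, without boundary) smooth manifold $X$ of real dimension $2n$, equipped with an effective smooth ($C^\infty$ over $\mathbb R$) action of $(\mathbb C^*)^n$ having an open dense orbit, such that $X$ is covered by finitely many invariant open subsets, each equivariantly diffeomorphic to a direct sum $V(\chi_1)\oplus\cdots\oplus V(\chi_n)$ of complex one-dimensional smooth representation spaces of $(\mathbb C^*)^n$. Here $\chi_1,\dots,\chi_n\colon(\mathbb C^*)^n\to\mathbb C^*$ are smooth group homomorphisms and $g$ acts on $\mathbb C^n$ by $(z_1,\dots,z_n)\mapsto(\chi_1(g)z_1,\dots,\chi_n(g)z_n)$. \textbf{Proposition.} Every topological toric manifold is connected and simply connected, and in particular orientable (it has an atlas of smooth charts whose coordinate changes all have positive Jacobian determinant). -/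

import Mathlib

open scoped Manifold ContDiff

/-- The Lie group `(ℂ*)ⁿ`, realized as the group of units of the product ring `ℂⁿ`: its elements are
the `n`-tuples of nonzero complex numbers with componentwise multiplication, and its smooth structure
(over `ℝ`) is the one of an open subset of `ℂⁿ`. -/
abbrev ComplexTorus (n : ℕ) : Type := (Fin n → ℂ)ˣ

/-- Smooth characters `(ℂ*)ⁿ → ℂ*`, that is, complex one-dimensional smooth representations of
`(ℂ*)ⁿ`. Smooth means `C^∞` over the reals. -/
abbrev SmoothCharacter (n : ℕ) : Type :=
  ContMDiffMonoidMorphism 𝓘(ℝ, Fin n → ℂ) 𝓘(ℝ, ℂ) ∞ (ComplexTorus n) ℂˣ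

/-- The action of `g` on the direct sum `V(χ₁) ⊕ ⋯ ⊕ V(χₙ)` of complex one-dimensional
representation spaces: multiplication of the `i`-th coordinate by `χᵢ(g)`. -/
noncomputable def directSumAction {n : ℕ} (χ : Fin n → SmoothCharacter n) (g : ComplexTorus n)
    (z : Fin n → ℂ) : Fin n → ℂ :=
  fun i => (χ i g : ℂ) * z i

/-- The open subset `U` of `X` is invariant under `(ℂ*)ⁿ` and equivariantly diffeomorphic to a direct
sum of complex one-dimensional smooth representation spaces of `(ℂ*)ⁿ`. As `X` has real dimension
`2n`, the number of summands is necessarily `n`. -/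
def IsRepresentationChart (n : ℕ) {X : Type*} [TopologicalSpace X]
    [ChartedSpace (EuclideanSpace ℝ (Fin (2 * n))) X] [MulAction (ComplexTorus n) X]
    (U : TopologicalSpace.Opens X) : Prop :=
  ∃ hU : ∀ (g : ComplexTorus n), ∀ x ∈ U, g • x ∈ U,
    ∃ (χ : Fin n → SmoothCharacter n)
      (φ : U ≃ₘ⟮𝓡 (2 * n), 𝓘(ℝ, Fin n → ℂ)⟯ (Fin n → ℂ)),
      ∀ (g : ComplexTorus n) (x : U),
        φ ⟨g • (x : X), hU g x x.2⟩ = directSumAction χ g (φ x)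

/-- Topological toric manifolds of real dimension `2n`: closed (that is, compact, Hausdorff and without
boundary) smooth manifolds of dimension `2n` with an effective smooth action of `(ℂ*)ⁿ` having an open
dense orbit, covered by finitely many invariant open subsets each equivariantly diffeomorphic to a
direct sum of complex one-dimensional smooth representation spaces. -/
structure IsTopologicalToricManifold (n : ℕ) (X : Type*) [TopologicalSpace X]
    [ChartedSpace (EuclideanSpace ℝ (Fin (2 * n))) X] [MulAction (ComplexTorus n) X] : Prop where
  t2Space : T2Space X
  compactSpace : CompactSpace X
  isManifold : IsManifold (𝓡 (2 * n)) ∞ X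
  smooth_action :
    ContMDiffSMul 𝓘(ℝ, Fin n → ℂ) (𝓡 (2 * n)) ∞ (ComplexTorus n) X
  effective : FaithfulSMul (ComplexTorus n) X
  exists_open_dense_orbit : ∃ x : X,
    IsOpen (MulAction.orbit (ComplexTorus n) x) ∧ Dense (MulAction.orbit (ComplexTorus n) x)
  exists_finite_cover : ∃ S : Set (TopologicalSpace.Opens X), S.Finite ∧
    (∀ x : X, ∃ U ∈ S, x ∈ U) ∧ ∀ U ∈ S, IsRepresentationChart n U

/-- A smooth `d`-manifold is orientable if it has an oriented atlas: a family of smooth charts that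
covers it and whose coordinate changes all have a positive Jacobian determinant. -/
def IsOrientableManifold (d : ℕ) (X : Type*) [TopologicalSpace X]
    [ChartedSpace (EuclideanSpace ℝ (Fin d)) X] : Prop :=
  ∃ A : Set (OpenPartialHomeomorph X (EuclideanSpace ℝ (Fin d))),
    A ⊆ IsManifold.maximalAtlas (𝓡 d) ∞ X ∧
    (∀ x : X, ∃ e ∈ A, x ∈ e.source) ∧
    ∀ e ∈ A, ∀ e' ∈ A, ∀ y ∈ (e.symm.trans e').source,
      0 < (fderiv ℝ (e.symm.trans e') y).det

open Set Filter Topology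

/-! ### Simple connectivity from an open cover -/

section SimplyConnected

open scoped unitInterval

variable {X : Type*} [TopologicalSpace X]

/-! The dense orbit is path connected and, by invariance, lies in every chart domain. Overlaps of
chart domains are therefore open sets containing a dense path connected set, hence path connected,
while each domain is a copy of `Fin n → ℂ`, hence simply connected.
`simplyConnectedSpace_of_open_cover` then applies with a base point `x₀` on the orbit. Orientability
is not deduced from simple connectivity: on a connected overlap the Jacobian sign is constant, so it
is enough to fix all signs at `x₀` (`isOrientableManifold_of_charts`). -/

theorem IsSimplyConnected.homotopic_of_mem {s : Set X} (hs : IsSimplyConnected s) {x y : X}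
    {p q : Path x y} (hp : ∀ t, p t ∈ s) (hq : ∀ t, q t ∈ s) : p.Homotopic q := by
  have := hs.simplyConnectedSpace
  have hx : x ∈ s := by simpa using hp 0
  have hy : y ∈ s := by simpa using hp 1
  let p' : Path (⟨x, hx⟩ : s) ⟨y, hy⟩ :=
    { toFun := fun t => ⟨p t, hp t⟩, source' := by simp, target' := by simp }
  let q' : Path (⟨x, hx⟩ : s) ⟨y, hy⟩ :=
    { toFun := fun t => ⟨q t, hq t⟩, source' := by simp, target' := by simp }
  exact (SimplyConnectedSpace.paths_homotopic p' q').map ⟨_, continuous_subtype_val⟩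

theorem Path.trans_mem {s : Set X} {x y z : X} {p : Path x y} {q : Path y z}
    (hp : ∀ t, p t ∈ s) (hq : ∀ t, q t ∈ s) (t : I) : p.trans q t ∈ s := by
  have h : p.trans q t ∈ range (p.trans q) := mem_range_self t
  rw [Path.trans_range] at h
  rcases h with ⟨u, hu⟩ | ⟨u, hu⟩
  · exact hu ▸ hp u
  · exact hu ▸ hq u

/-- Both paths are compared with a third one inside `U i ∩ U j`. -/
theorem homotopic_of_mem_of_mem {ι : Type*} {U : ι → Set X}
    (hs : ∀ i, IsSimplyConnected (U i)) (hint : ∀ i j, IsPathConnected (U i ∩ U j)) {x y : X}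
    {p q : Path x y} {i j : ι} (hp : ∀ t, p t ∈ U i) (hq : ∀ t, q t ∈ U j) : p.Homotopic q := by
  have hx : x ∈ U i ∩ U j := ⟨by simpa using hp 0, by simpa using hq 0⟩
  have hy : y ∈ U i ∩ U j := ⟨by simpa using hp 1, by simpa using hq 1⟩
  obtain ⟨r, hr⟩ := (hint i j).joinedIn x hx y hy
  exact ((hs i).homotopic_of_mem hp fun t => (hr t).1).trans
    ((hs j).homotopic_of_mem (fun t => (hr t).2) hq)

/-- If an open cover by simply connected sets has a common point `x₀` and path connected pairwise
intersections, then a path followed by a short path to `x₀` is homotopic to any short path to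
`x₀`, where short means contained in a member of the cover. -/
theorem trans_homotopic_of_open_cover {ι : Type*} {U : ι → Set X} (ho : ∀ i, IsOpen (U i))
    (hcov : ∀ x, ∃ i, x ∈ U i) (hs : ∀ i, IsSimplyConnected (U i))
    (hint : ∀ i j, IsPathConnected (U i ∩ U j)) {x₀ : X} (hx₀ : ∀ i, x₀ ∈ U i) {x y : X}
    (p : Path x y) {i j : ι} {q : Path y x₀} {r : Path x x₀} (hq : ∀ t, q t ∈ U i)
    (hr : ∀ t, r t ∈ U j) : (p.trans q).Homotopic r := by
  obtain ⟨t, ht0, htm, ⟨N, hN⟩, ht⟩ := exists_monotone_Icc_subset_open_cover_unitInterval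
    (c := fun i => p ⁻¹' U i) (fun i => (ho i).preimage p.continuous)
    (fun s _ => mem_iUnion.2 (hcov (p s)))
  let r' : Path (p 0) x₀ := r.cast p.source rfl
  -- The invariant quantifies over all short tails `δ`, so the induction step may change the tail
  -- and the member containing it.
  let Q : I → Prop := fun s => ∀ (k : ι) (δ : Path (p s) x₀), (∀ u, δ u ∈ U k) →
    ((p.subpath 0 s).trans δ).Homotopic r'
  have hQ : ∀ m, Q (t m) := by
    intro m
    induction m with
    | zero =>
      rw [ht0]
      intro k δ hδ
      rw [Path.subpath_self]
      refine Path.Homotopic.trans (⟨Path.Homotopy.reflTrans δ⟩) ?_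
      exact homotopic_of_mem_of_mem hs hint hδ hr
    | succ m ih =>
      intro k δ hδ
      obtain ⟨l, hl⟩ := ht m
      have hle : t m ≤ t (m + 1) := htm (Nat.le_succ m)
      have hmem : p (t (m + 1)) ∈ U k ∩ U l :=
        ⟨by simpa using hδ 0, hl ⟨hle, le_rfl⟩⟩
      -- `η` replaces `δ` up to homotopy in `U k`; as it also lies in `U l`, prefixing the next
      -- segment of `p` gives a short tail at `t m`.
      obtain ⟨η, hη⟩ := (hint k l).joinedIn _ hmem x₀ ⟨hx₀ k, hx₀ l⟩
      have hsub : ∀ u, p.subpath (t m) (t (m + 1)) u ∈ U l := by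
        intro u
        have h : p.subpath (t m) (t (m + 1)) u ∈ range (p.subpath (t m) (t (m + 1))) :=
          mem_range_self u
        rw [Path.range_subpath_of_le _ _ _ hle] at h
        obtain ⟨v, hv, hv'⟩ := h
        exact hv' ▸ hl hv
      have h1 : δ.Homotopic η := (hs k).homotopic_of_mem hδ fun u => (hη u).1
      have h2 := ih l _ (Path.trans_mem hsub fun u => (hη u).2)
      have h3 : ((p.subpath 0 (t m)).trans (p.subpath (t m) (t (m + 1)))).Homotopic
          (p.subpath 0 (t (m + 1))) := ⟨Path.Homotopy.subpathTransSubpath p _ _ _⟩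
      refine (h3.symm.hcomp h1).trans (Path.Homotopic.trans ?_ h2)
      exact ⟨Path.Homotopy.transAssoc _ _ _⟩
  have h1 : Q 1 := hN N le_rfl ▸ hQ N
  have h2 := (h1 i (q.cast p.target rfl) hq).pathCast p.source.symm rfl
  rw [Path.subpath_zero_one] at h2
  exact h2

/-- A weak form of the Seifert–van Kampen theorem: a space covered by simply connected open sets
with a common point and path connected pairwise intersections is simply connected. -/
theorem simplyConnectedSpace_of_open_cover {ι : Type*} {U : ι → Set X} (ho : ∀ i, IsOpen (U i))
    (hcov : ∀ x, ∃ i, x ∈ U i) (hs : ∀ i, IsSimplyConnected (U i))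
    (hint : ∀ i j, IsPathConnected (U i ∩ U j)) {x₀ : X} (hx₀ : ∀ i, x₀ ∈ U i) :
    SimplyConnectedSpace X := by
  have hj : ∀ x, ∃ (i : ι) (q : Path x x₀), ∀ t, q t ∈ U i := fun x => by
    obtain ⟨i, hi⟩ := hcov x
    obtain ⟨q, hq⟩ := (hs i).isPathConnected.joinedIn x hi x₀ (hx₀ i)
    exact ⟨i, q, hq⟩
  rw [simply_connected_iff_paths_homotopic']
  refine ⟨⟨⟨x₀⟩, fun x y => ?_⟩, fun {x y} p₁ p₂ => ?_⟩
  · obtain ⟨-, q, -⟩ := hj x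
    obtain ⟨-, r, -⟩ := hj y
    exact ⟨q.trans r.symm⟩
  · obtain ⟨i, q, hq⟩ := hj y
    obtain ⟨j, r, hr⟩ := hj x
    have h := (trans_homotopic_of_open_cover ho hcov hs hint hx₀ p₁ hq hr).trans
      (trans_homotopic_of_open_cover ho hcov hs hint hx₀ p₂ hq hr).symm
    have key : ∀ p : Path x y, p.Homotopic ((p.trans q).trans q.symm) := fun p =>
      Path.Homotopic.symm <| Path.Homotopic.trans ⟨Path.Homotopy.transAssoc _ _ _⟩ <|
        ((Path.Homotopic.refl p).hcomp
          (Path.Homotopic.symm ⟨Path.Homotopy.reflTransSymm q⟩)).trans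
          ⟨Path.Homotopy.transRefl p⟩
    exact (key p₁).trans ((h.hcomp (.refl _)).trans (key p₂).symm)

/-- Path connectedness of an open set that contains a dense path connected set. -/
theorem IsOpen.isPathConnected_of_dense_subset [LocallyPathConnectedSpace X] {s t : Set X}
    (hs : IsOpen s) (ht : IsPathConnected t) (hd : Dense t) (hts : t ⊆ s) :
    IsPathConnected s := by
  obtain ⟨x, hx, hxt⟩ := ht
  refine ⟨x, hts hx, fun y hy => ?_⟩
  -- By local path connectedness the path component of `y` in `s` is open, so it meets `t`.
  obtain ⟨z, hz, hzt⟩ := hd.inter_open_nonempty _ (hs.pathComponentIn y)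
    ⟨y, mem_pathComponentIn_self hy⟩
  exact ((hxt hzt).mono hts).trans (JoinedIn.symm hz)

end SimplyConnected

/-! ### Jacobian signs and oriented atlases -/

section Orientable

theorem OpenPartialHomeomorph.mem_symm_trans_source {M E : Type*} [TopologicalSpace M]
    [TopologicalSpace E] {e e' : OpenPartialHomeomorph M E} {x : M} (hx : x ∈ e.source)
    (hx' : x ∈ e'.source) : e x ∈ (e.symm.trans e').source := by
  simp [hx, hx']

variable {E : Type*} [NormedAddCommGroup E] [NormedSpace ℝ E]
  {M : Type*} [TopologicalSpace M]

/-- The Jacobian determinant at `x` of the coordinate change from `e` to `e'`. -/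
noncomputable def jacobian (e e' : OpenPartialHomeomorph M E) (x : M) : ℝ :=
  (fderiv ℝ (e.symm.trans e') (e x)).det

variable {e e' e'' : OpenPartialHomeomorph M E}

theorem jacobian_self {x : M} (hx : x ∈ e.source) : jacobian e e x = 1 := by
  have hev : e.symm.trans e =ᶠ[𝓝 (e x)] id := by
    filter_upwards [e.open_target.mem_nhds (e.map_source hx)] with y hy
    simp [e.right_inv hy]
  rw [jacobian, hev.fderiv_eq, fderiv_id, ContinuousLinearMap.det]
  simp

theorem jacobian_transHomeomorph (R : E ≃L[ℝ] E) (x : M) :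
    jacobian e (e'.transHomeomorph R.toHomeomorph) x =
      (R : E →L[ℝ] E).det * jacobian e e' x := by
  have h : ⇑(e.symm.trans (e'.transHomeomorph R.toHomeomorph)) = R ∘ (e.symm.trans e') := rfl
  rw [jacobian, h, R.comp_fderiv, jacobian]
  simp only [ContinuousLinearMap.det, ContinuousLinearMap.toLinearMap_comp, LinearMap.det_comp]

variable [ChartedSpace E M]

theorem contDiffOn_symm_trans
    (he : e ∈ IsManifold.maximalAtlas 𝓘(ℝ, E) ∞ M)
    (he' : e' ∈ IsManifold.maximalAtlas 𝓘(ℝ, E) ∞ M) :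
    ContDiffOn ℝ ∞ (e.symm.trans e') (e.symm.trans e').source := by
  rw [← contMDiffOn_iff_contDiffOn]
  exact contMDiffOn_of_mem_contDiffGroupoid (IsManifold.compatible_of_mem_maximalAtlas he he')

theorem mem_maximalAtlas_of_contMDiffOn [IsManifold 𝓘(ℝ, E) ∞ M]
    (h : ContMDiffOn 𝓘(ℝ, E) 𝓘(ℝ, E) ∞ e e.source)
    (h' : ContMDiffOn 𝓘(ℝ, E) 𝓘(ℝ, E) ∞ e.symm e.target) :
    e ∈ IsManifold.maximalAtlas 𝓘(ℝ, E) ∞ M := by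
  rw [IsManifold.mem_maximalAtlas_iff]
  intro f hf
  have hf' := IsManifold.subset_maximalAtlas (I := 𝓘(ℝ, E)) (n := ∞) hf
  have h1 : ContDiffOn ℝ ∞ (f ∘ e.symm) (e.symm.trans f).source := by
    rw [← contMDiffOn_iff_contDiffOn]
    refine ((contMDiffOn_of_mem_maximalAtlas hf').comp' h').mono ?_
    mfld_set_tac
  have h2 : ContDiffOn ℝ ∞ (e ∘ f.symm) (f.symm.trans e).source := by
    rw [← contMDiffOn_iff_contDiffOn]
    refine (h.comp' (contMDiffOn_symm_of_mem_maximalAtlas hf')).mono ?_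
    mfld_set_tac
  have key : ∀ g : OpenPartialHomeomorph E E, ContDiffOn ℝ ∞ g g.source →
      ContDiffOn ℝ ∞ g.symm g.target → g ∈ contDiffGroupoid ∞ 𝓘(ℝ, E) := by
    intro g hg hg'
    rw [contDiffGroupoid, mem_groupoid_of_pregroupoid]
    simpa [contDiffPregroupoid] using ⟨hg, hg'⟩
  exact ⟨key _ h1 (by simpa [OpenPartialHomeomorph.trans_symm_eq_symm_trans_symm] using h2),
    key _ h2 (by simpa [OpenPartialHomeomorph.trans_symm_eq_symm_trans_symm] using h1)⟩

theorem differentiableAt_symm_trans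
    (he : e ∈ IsManifold.maximalAtlas 𝓘(ℝ, E) ∞ M)
    (he' : e' ∈ IsManifold.maximalAtlas 𝓘(ℝ, E) ∞ M) {x : M} (hx : x ∈ e.source)
    (hx' : x ∈ e'.source) : DifferentiableAt ℝ (e.symm.trans e') (e x) :=
  ((contDiffOn_symm_trans he he').differentiableOn (by simp)).differentiableAt
    ((e.symm.trans e').open_source.mem_nhds (OpenPartialHomeomorph.mem_symm_trans_source hx hx'))

theorem jacobian_mul
    (he : e ∈ IsManifold.maximalAtlas 𝓘(ℝ, E) ∞ M)
    (he' : e' ∈ IsManifold.maximalAtlas 𝓘(ℝ, E) ∞ M)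
    (he'' : e'' ∈ IsManifold.maximalAtlas 𝓘(ℝ, E) ∞ M) {x : M} (hx : x ∈ e.source)
    (hx' : x ∈ e'.source) (hx'' : x ∈ e''.source) :
    jacobian e' e'' x * jacobian e e' x = jacobian e e'' x := by
  have hev : e.symm.trans e'' =ᶠ[𝓝 (e x)] (e'.symm.trans e'') ∘ (e.symm.trans e') := by
    filter_upwards [(e.symm.trans e').open_source.mem_nhds
      (OpenPartialHomeomorph.mem_symm_trans_source hx hx')] with y hy
    simp only [OpenPartialHomeomorph.trans_source, mem_inter_iff, mem_preimage] at hy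
    simp [e'.left_inv hy.2]
  have h1 : (e.symm.trans e') (e x) = e' x := by simp [e.left_inv hx]
  have h2 := differentiableAt_symm_trans he' he'' hx' hx''
  rw [← h1] at h2
  rw [jacobian, jacobian, jacobian, hev.fderiv_eq,
    fderiv_comp _ h2 (differentiableAt_symm_trans he he' hx hx'), h1]
  simp only [ContinuousLinearMap.det, ContinuousLinearMap.toLinearMap_comp, LinearMap.det_comp]

/-- By the cocycle rule, the Jacobian of the reverse coordinate change is an inverse. -/
theorem jacobian_ne_zero
    (he : e ∈ IsManifold.maximalAtlas 𝓘(ℝ, E) ∞ M)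
    (he' : e' ∈ IsManifold.maximalAtlas 𝓘(ℝ, E) ∞ M) {x : M} (hx : x ∈ e.source)
    (hx' : x ∈ e'.source) : jacobian e e' x ≠ 0 := by
  have h := jacobian_mul he he' he hx hx' hx
  rw [jacobian_self hx] at h
  exact right_ne_zero_of_mul_eq_one h

theorem continuousOn_jacobian [FiniteDimensional ℝ E]
    (he : e ∈ IsManifold.maximalAtlas 𝓘(ℝ, E) ∞ M)
    (he' : e' ∈ IsManifold.maximalAtlas 𝓘(ℝ, E) ∞ M) :
    ContinuousOn (jacobian e e') (e.source ∩ e'.source) := by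
  have h := (contDiffOn_symm_trans he he').continuousOn_fderiv_of_isOpen
    (e.symm.trans e').open_source (by simp)
  exact (ContinuousLinearMap.continuous_det.comp_continuousOn h).comp
    (e.continuousOn.mono inter_subset_left) fun x hx =>
      OpenPartialHomeomorph.mem_symm_trans_source hx.1 hx.2

theorem jacobian_pos_of_isPreconnected [FiniteDimensional ℝ E]
    (he : e ∈ IsManifold.maximalAtlas 𝓘(ℝ, E) ∞ M)
    (he' : e' ∈ IsManifold.maximalAtlas 𝓘(ℝ, E) ∞ M)
    (hc : IsPreconnected (e.source ∩ e'.source)) {x₀ x : M} (hx₀ : x₀ ∈ e.source ∩ e'.source)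
    (hx : x ∈ e.source ∩ e'.source) (hpos : 0 < jacobian e e' x₀) : 0 < jacobian e e' x := by
  by_contra! hneg
  obtain ⟨y, hy, hy0⟩ := hc.intermediate_value hx hx₀ (continuousOn_jacobian he he')
    ⟨hneg, hpos.le⟩
  exact jacobian_ne_zero he he' hy.1 hy.2 hy0

theorem transHomeomorph_mem_maximalAtlas [IsManifold 𝓘(ℝ, E) ∞ M]
    (he : e ∈ IsManifold.maximalAtlas 𝓘(ℝ, E) ∞ M) (R : E ≃L[ℝ] E) :
    e.transHomeomorph R.toHomeomorph ∈ IsManifold.maximalAtlas 𝓘(ℝ, E) ∞ M :=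
  mem_maximalAtlas_of_contMDiffOn
    (R.contDiff.contMDiff.comp_contMDiffOn (contMDiffOn_of_mem_maximalAtlas he))
    ((contMDiffOn_symm_of_mem_maximalAtlas he).comp R.symm.contDiff.contMDiff.contMDiffOn
      fun _ hx => hx)

theorem exists_continuousLinearEquiv_det_neg (E : Type*) [NormedAddCommGroup E]
    [InnerProductSpace ℝ E] [FiniteDimensional ℝ E] [Nontrivial E] :
    ∃ R : E ≃L[ℝ] E, (R : E →L[ℝ] E).det < 0 := by
  obtain ⟨v, hv⟩ := exists_ne (0 : E)
  refine ⟨((ℝ ∙ v)ᗮ.reflection).toContinuousLinearEquiv, ?_⟩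
  have h : LinearMap.det (ℝ ∙ v)ᗮ.reflection.toLinearMap = -1 := by
    rw [Submodule.det_reflection, Submodule.orthogonal_orthogonal, finrank_span_singleton hv,
      pow_one]
  exact h.trans_lt (by norm_num)

/-- Charts with negative Jacobian at `x₀` relative to a reference chart `e₀` are composed with a
reflection. The cocycle rule then makes all changes positive at `x₀`, and connected overlaps
propagate the sign. -/
theorem isOrientableManifold_of_charts {d : ℕ} {X : Type*} [TopologicalSpace X]
    [ChartedSpace (EuclideanSpace ℝ (Fin d)) X] [IsManifold (𝓡 d) ∞ X]
    {A : Set (OpenPartialHomeomorph X (EuclideanSpace ℝ (Fin d)))}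
    (hA : A ⊆ IsManifold.maximalAtlas (𝓡 d) ∞ X) (hcov : ∀ x, ∃ e ∈ A, x ∈ e.source) {x₀ : X}
    (hx₀ : ∀ e ∈ A, x₀ ∈ e.source)
    (hc : ∀ e ∈ A, ∀ e' ∈ A, IsPreconnected (e.source ∩ e'.source)) :
    IsOrientableManifold d X := by
  obtain ⟨e₀, he₀, -⟩ := hcov x₀
  have key : ∀ e ∈ A, ∃ e' ∈ IsManifold.maximalAtlas (𝓡 d) ∞ X, e'.source = e.source ∧
      0 < jacobian e₀ e' x₀ := by
    intro e he
    rcases (jacobian_ne_zero (hA he₀) (hA he) (hx₀ _ he₀) (hx₀ _ he)).lt_or_gt with h | h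
    -- In dimension zero there is no reflection, but every determinant is 1.
    · cases subsingleton_or_nontrivial (EuclideanSpace ℝ (Fin d)) with
      | inl h' =>
        rw [jacobian, ContinuousLinearMap.det, LinearMap.det_eq_one_of_subsingleton] at h
        exact absurd h (by norm_num)
      | inr h' =>
        obtain ⟨R, hR⟩ := exists_continuousLinearEquiv_det_neg (EuclideanSpace ℝ (Fin d))
        refine ⟨_, transHomeomorph_mem_maximalAtlas (hA he) R, rfl, ?_⟩
        rw [jacobian_transHomeomorph]
        exact mul_pos_of_neg_of_neg hR h
    · exact ⟨e, hA he, rfl, h⟩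
  refine ⟨{e' | e' ∈ IsManifold.maximalAtlas (𝓡 d) ∞ X ∧ 0 < jacobian e₀ e' x₀ ∧
    ∃ e ∈ A, e'.source = e.source}, fun _ h => h.1, fun x => ?_, ?_⟩
  · obtain ⟨e, he, hx⟩ := hcov x
    obtain ⟨e', he', hs, hpos⟩ := key e he
    exact ⟨e', ⟨he', hpos, e, he, hs⟩, hs ▸ hx⟩
  · rintro e ⟨he, hpos, f, hf, hs⟩ e' ⟨he', hpos', f', hf', hs'⟩ y hy
    have hx : x₀ ∈ e.source := hs ▸ hx₀ f hf
    have hx' : x₀ ∈ e'.source := hs' ▸ hx₀ f' hf'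
    have h0 : 0 < jacobian e e' x₀ := by
      have := jacobian_mul (hA he₀) he he' (hx₀ _ he₀) hx hx'
      exact pos_of_mul_pos_left (this ▸ hpos') hpos.le
    simp only [OpenPartialHomeomorph.trans_source, OpenPartialHomeomorph.symm_source,
      mem_inter_iff, mem_preimage] at hy
    have h1 := jacobian_pos_of_isPreconnected he he' (by rw [hs, hs']; exact hc f hf f' hf')
      ⟨hx, hx'⟩ ⟨e.map_target hy.1, hy.2⟩ h0
    rwa [jacobian, e.right_inv hy.1] at h1

end Orientable

/-! ### The dense orbit and the representation charts -/

section Toric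

/-- The coordinatewise exponential maps `Fin n → ℂ` onto the torus. -/
theorem isPathConnected_orbit_complexTorus {n : ℕ} {X : Type*} [TopologicalSpace X]
    [MulAction (ComplexTorus n) X] [ContinuousSMul (ComplexTorus n) X] (x : X) :
    IsPathConnected (MulAction.orbit (ComplexTorus n) x) := by
  let f : (Fin n → ℂ) → ComplexTorus n := fun z =>
    ⟨fun i => Complex.exp (z i), fun i => Complex.exp (-z i),
      by ext i; simp [← Complex.exp_add], by ext i; simp [← Complex.exp_add]⟩
  have hf : Continuous f := by
    refine Units.continuous_iff.2 ⟨?_, ?_⟩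
    · exact continuous_pi fun i => Complex.continuous_exp.comp (continuous_apply i)
    · exact continuous_pi fun i => Complex.continuous_exp.comp (continuous_apply i).neg
  have hsurj : Function.Surjective f := by
    intro g
    refine ⟨fun i => Complex.log ((g : Fin n → ℂ) i), Units.ext (funext fun i => ?_)⟩
    refine Complex.exp_log fun h => ?_
    have := congrFun g.mul_inv i
    simp [h] at this
  have : MulAction.orbit (ComplexTorus n) x = range fun z => f z • x :=
    (hsurj.range_comp fun g => g • x).symm
  rw [this]
  exact isPathConnected_range (hf.smul continuous_const)

variable {n : ℕ} {X : Type*} [TopologicalSpace X]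
  [ChartedSpace (EuclideanSpace ℝ (Fin (2 * n))) X] [MulAction (ComplexTorus n) X]
  {U : TopologicalSpace.Opens X}

theorem IsRepresentationChart.isSimplyConnected (hU : IsRepresentationChart n U) :
    IsSimplyConnected (U : Set X) := by
  obtain ⟨-, -, φ, -⟩ := hU
  exact φ.toHomeomorph.toHomotopyEquiv.simplyConnectedSpace

theorem IsRepresentationChart.orbit_subset (hU : IsRepresentationChart n U) {x : X}
    (hx : Dense (MulAction.orbit (ComplexTorus n) x)) :
    MulAction.orbit (ComplexTorus n) x ⊆ U := by
  have hne : (U : Set X).Nonempty := hU.isSimplyConnected.nonempty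
  obtain ⟨hinv, -⟩ := hU
  obtain ⟨-, hg, g, rfl⟩ := hx.inter_open_nonempty U U.isOpen hne
  rintro - ⟨h, rfl⟩
  have := hinv (h * g⁻¹) _ hg
  simpa [mul_smul] using this

theorem IsRepresentationChart.exists_mem_maximalAtlas [IsManifold (𝓡 (2 * n)) ∞ X]
    (hU : IsRepresentationChart n U) :
    ∃ e ∈ IsManifold.maximalAtlas (𝓡 (2 * n)) ∞ X, e.source = U := by
  obtain ⟨-, -, φ, -⟩ := hU
  -- Any real linear identification will do, since orientations are corrected later.
  let L : EuclideanSpace ℝ (Fin (2 * n)) ≃L[ℝ] (Fin n → ℂ) :=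
    ContinuousLinearEquiv.ofFinrankEq (by simp [Module.finrank_pi_fintype, mul_comm])
  let f : EuclideanSpace ℝ (Fin (2 * n)) → X := fun v => φ.symm (L v)
  have hf : IsOpenEmbedding f := U.isOpen.isOpenEmbedding_subtypeVal.comp
    (L.toHomeomorph.trans φ.symm.toHomeomorph).isOpenEmbedding
  have hrange : range f = U := by
    have : f = Subtype.val ∘ (L.toHomeomorph.trans φ.symm.toHomeomorph) := rfl
    rw [this, (Homeomorph.surjective _).range_comp, Subtype.range_coe]
  have hval : ∀ x : U, (hf.toOpenPartialHomeomorph f).symm (x : X) = L.symm (φ x) := by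
    intro x
    have : f (L.symm (φ x)) = x := by simp [f]
    rw [← this, hf.toOpenPartialHomeomorph_left_inv]
  refine ⟨(hf.toOpenPartialHomeomorph f).symm, mem_maximalAtlas_of_contMDiffOn ?_ ?_, ?_⟩
  · intro x hx
    have hx : x ∈ U := by simpa [hrange] using hx
    refine ContMDiffAt.contMDiffWithinAt ?_
    rw [show x = ((⟨x, hx⟩ : U) : X) from rfl, ← contMDiffAt_subtype_iff]
    simp_rw [hval]
    exact (L.symm.contDiff.contMDiff.comp φ.contMDiff).contMDiffAt
  · exact (contMDiff_subtype_val.comp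
      (φ.symm.contMDiff.comp L.contDiff.contMDiff)).contMDiffOn
  · simp [hrange]

end Toric

theorem proposition3p4 (n : ℕ) (X : Type*) [TopologicalSpace X]
    [ChartedSpace (EuclideanSpace ℝ (Fin (2 * n))) X] [MulAction (ComplexTorus n) X]
    (hX : IsTopologicalToricManifold n X) :
    ConnectedSpace X ∧ SimplyConnectedSpace X ∧ IsOrientableManifold (2 * n) X := by
  have := hX.isManifold
  have := hX.smooth_action
  have : ContinuousSMul (ComplexTorus n) X :=
    ContMDiffSMul.continuousSMul (I := 𝓘(ℝ, Fin n → ℂ)) (I' := 𝓡 (2 * n)) (n := ∞)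
  have : LocallyPathConnectedSpace X :=
    ChartedSpace.locallyPathConnectedSpace (EuclideanSpace ℝ (Fin (2 * n))) X
  obtain ⟨x₀, -, hd⟩ := hX.exists_open_dense_orbit
  obtain ⟨S, -, hcov, hS⟩ := hX.exists_finite_cover
  have hsub : ∀ U ∈ S, MulAction.orbit (ComplexTorus n) x₀ ⊆ U := fun U hU =>
    (hS U hU).orbit_subset hd
  have hmem : ∀ U ∈ S, x₀ ∈ U := fun U hU => hsub U hU (MulAction.mem_orbit_self x₀)
  have hint : ∀ U ∈ S, ∀ V ∈ S, IsPathConnected ((U : Set X) ∩ V) := fun U hU V hV =>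
    (U.isOpen.inter V.isOpen).isPathConnected_of_dense_subset
      (isPathConnected_orbit_complexTorus x₀) hd (subset_inter (hsub U hU) (hsub V hV))
  have hsc : SimplyConnectedSpace X :=
    simplyConnectedSpace_of_open_cover (U := fun U : S => ((U : TopologicalSpace.Opens X) : Set X))
      (fun U => U.1.isOpen) (fun x => by obtain ⟨U, hU, hx⟩ := hcov x; exact ⟨⟨U, hU⟩, hx⟩)
      (fun U => (hS U U.2).isSimplyConnected) (fun U V => hint U U.2 V V.2)
      (fun U => hmem U U.2)
  refine ⟨inferInstance, hsc, ?_⟩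
  refine isOrientableManifold_of_charts
    (A := {e | e ∈ IsManifold.maximalAtlas (𝓡 (2 * n)) ∞ X ∧ ∃ U ∈ S, e.source = U})
    (fun e he => he.1) (fun x => ?_) (x₀ := x₀) ?_ ?_
  · obtain ⟨U, hU, hx⟩ := hcov x
    obtain ⟨e, he, hs⟩ := (hS U hU).exists_mem_maximalAtlas
    exact ⟨e, ⟨he, U, hU, hs⟩, hs ▸ hx⟩
  · rintro e ⟨-, U, hU, hs⟩
    exact hs ▸ hmem U hU
  · rintro e ⟨-, U, hU, hs⟩ e' ⟨-, V, hV, hs'⟩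
    rw [hs, hs']
    exact (hint U hU V hV).isConnected.isPreconnected
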